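/- \textbf{The logic.} Signatures $\sigma$ and structures are finite, structures are non-empty, and all relation symbols have positive arity. Fix a countably infinite set of \emph{structure variables} (ranging over elements of the structure) and a disjoint countably infinite set of \emph{number variables} (ranging over $\mathbb{Z}$). A \emph{numerical predicate collection} $\mathbb{P}$ is a countable set of predicate names $\mathsf{P}$, each with an arity $m\ge 1$ and an arbitrary semantics $[\![\mathsf{P}]\!]\subseteq\mathbb{Z}^m$. The formulas and counting terms of $\mathrm{FOCN}(\mathbb{P})[\sigma]$ are built by the following rules. \begin{itemize} \item Formulas: $x_1{=}x_2$ and $R(x_1,\dots,x_n)$ with $R\in\sigma$ of arity $n$, where the $x_i$ are structure variables or constant symbols of $\sigma$; $\neg\varphi$; $(\varphi\lor\psi)$; $\exists y\,\varphi$ for a structure variable $y$; $\mathsf{P}(t_1,\dots,t_m)$ for $\mathsf{P}\in\mathbb{P}$ of arity $m$ and counting terms $t_i$, which is true if and only if the tuple of the values of $t_1,\dots,t_m$ lies in $[\![\mathsf{P}]\!]$; $\exists\kappa\,\varphi$ for a number variable $\kappa$, which in a structure $\mathcal{A}$ with universe $A$ quantifies over $\{0,1,\dots,|A|\}$. \item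 Counting terms: $\#(y_1,\dots,y_k).\varphi$ for $k\ge1$ and pairwise distinct structure variables $y_i$, whose value is the number of tuples in $A^k$ that satisfy $\varphi$ when assigned to $(y_1,\dots,y_k)$; every integer; every number variable; $(t_1+t_2)$ and $(t_1\cdot t_2)$. \end{itemize} The \emph{binding rank} $\mathrm{br}(\varphi)$ is the maximal nesting depth of the constructs $\exists y$ ($y$ a structure variable) and $\#(y_1,\dots,y_k)$ in $\varphi$. The \emph{binding width} $\mathrm{bw}(\varphi)$ is the maximum of $0$, of $1$ if some $\exists y$ with $y$ a structure variable occurs in $\varphi$, and of the numbers $k$ for all terms $\#(y_1,\dots,y_k).\psi$ that occur in $\varphi$. Number quantifiers $\exists\kappa$ contribute to neither. \textbf{Hanf-locality.} Let $\sigma$ be a relational signature (no constant symbols). The \emph{Gaifman graph} of a $\sigma$-structure $\mathcal{A}$ has vertex set $A$ and joins two distinct elements if they occur together in a tuple of some relation of $\mathcal{A}$. For $\bar a\in A^n$ with $n\ge 1$, the \emph{$r$-sphere} $\mathcal{N}_r^{\mathcal{A}}(\bar a)$ is the substructure of $\mathcal{A}$ induced on the elements at Gaifman distance at most $r$ from some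 entry of $\bar a$, together with the distinguished tuple $\bar a$. For $k\ge 0$, $\bar a\in A^k$ and $\bar b\in B^k$, write $(\mathcal{A},\bar a)\leftrightharpoons_r(\mathcal{B},\bar b)$ if there is a bijection $f\colon A\to B$ such that $\mathcal{N}_r^{\mathcal{A}}(\bar a,c)\cong\mathcal{N}_r^{\mathcal{B}}(\bar b,f(c))$ for all $c\in A$. A formula $\varphi(x_1,\dots,x_k)$ over $\sigma$, i.e. one whose free variables all belong to the set of the pairwise distinct structure variables $x_1,\dots,x_k$, is \emph{Hanf-local} if there is some $r\ge0$ such that for all $\sigma$-structures $\mathcal{A},\mathcal{B}$ and all $\bar a\in A^k$, $\bar b\in B^k$ with $(\mathcal{A},\bar a)\leftrightharpoons_r(\mathcal{B},\bar b)$ we have $\mathcal{A}\models\varphi[\bar a]\iff\mathcal{B}\models\varphi[\bar b]$. The least such $r$ is the \emph{Hanf-locality rank} $\mathrm{lr}(\varphi)$ of $\varphi$. \textbf{Corollary.} Let $\mathbb{P}$ be a numerical predicate collection and $\sigma$ a relational signature. Every formula $\varphi(\bar x)$ of $\mathrm{FOCN}(\mathbb{P})[\sigma]$ without free number variables is Hanf-local,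 and its Hanf-locality rank satisfies \[ \mathrm{lr}(\varphi)\;<\;(2\,\mathrm{bw}(\varphi)+1)^{\mathrm{br}(\varphi)} . \] -/

import Mathlib

universe u v w p

namespace FOCN

/-- A numerical predicate collection: a countable set of predicate names, each with a positive
arity `m` and a semantics, which is an `m`-ary relation on the integers. -/
structure NumPredCollection where
  Name : Type p
  countable : Countable Name
  arity : Name → ℕ
  arity_pos : ∀ P, 0 < arity P
  sem : (P : Name) → Set (Fin (arity P) → ℤ)

/-- The variables of the logic: a countably infinite supply of structure variables, and a disjoint
countably infinite supply of number variables. -/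
inductive Var where
  | str : ℕ → Var
  | num : ℕ → Var

/-- An argument of an atomic formula: a structure variable (given by its index) or a constant
symbol of the signature. -/
abbrev Arg (L : FirstOrder.Language.{u, v}) := ℕ ⊕ L.Constants

mutual

/-- The formulas of `FOCN(P)[L]`. Of the function symbols of `L`, only those of arity zero (the
constant symbols) are used. -/
inductive Formula (L : FirstOrder.Language.{u, v}) (P : NumPredCollection.{p}) : Type (max u v p)
  | eq : Arg L → Arg L → Formula L P
  | rel : {n : ℕ} → L.Relations n → (Fin n → Arg L) → Formula L P
  | not : Formula L P → Formula L P
  | or : Formula L P → Formula L P → Formula L P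
  | exStr : ℕ → Formula L P → Formula L P
  | pred : (Q : P.Name) → (Fin (P.arity Q) → CountingTerm L P) → Formula L P
  | exNum : ℕ → Formula L P → Formula L P

/-- The counting terms of `FOCN(P)[L]`. The term `count k hk y φ` is `#(y₁,…,yₖ).φ`, where `k` is
positive and the structure variables `y₁,…,yₖ` are pairwise distinct. -/
inductive CountingTerm (L : FirstOrder.Language.{u, v}) (P : NumPredCollection.{p}) : Type (max u v p)
  | count : (k : ℕ) → 0 < k → (Fin k ↪ ℕ) → Formula L P → CountingTerm L P
  | int : ℤ → CountingTerm L P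
  | add : CountingTerm L P → CountingTerm L P → CountingTerm L P
  | mul : CountingTerm L P → CountingTerm L P → CountingTerm L P
  | numVar : ℕ → CountingTerm L P

end

section SyntaxMeasures

variable {L : FirstOrder.Language.{u, v}} {P : NumPredCollection.{p}}

/-- The variables that occur in an argument of an atomic formula. -/
def Arg.vars : Arg L → Set Var
  | Sum.inl x => {Var.str x}
  | Sum.inr _ => ∅

mutual

/-- The free variables of a formula. -/
def Formula.free : Formula L P → Set Var
  | .eq s t => Arg.vars s ∪ Arg.vars t
  | .rel _ ts => ⋃ i, Arg.vars (ts i)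
  | .not φ => φ.free
  | .or φ ψ => φ.free ∪ ψ.free
  | .exStr y φ => φ.free \ {Var.str y}
  | .pred _ ts => ⋃ i, (ts i).free
  | .exNum κ φ => φ.free \ {Var.num κ}

/-- The free variables of a counting term. -/
def CountingTerm.free : CountingTerm L P → Set Var
  | .count _ _ y φ => φ.free \ Set.range (fun j => Var.str (y j))
  | .int _ => ∅
  | .add s t => s.free ∪ t.free
  | .mul s t => s.free ∪ t.free
  | .numVar κ => {Var.num κ}

end

mutual

/-- The binding rank of a formula. -/
def Formula.br : Formula L P → ℕ
  | .eq _ _ => 0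
  | .rel _ _ => 0
  | .not φ => φ.br
  | .or φ ψ => max φ.br ψ.br
  | .exStr _ φ => φ.br + 1
  | .pred _ ts => Finset.univ.sup fun i => (ts i).br
  | .exNum _ φ => φ.br

/-- The binding rank of a counting term. -/
def CountingTerm.br : CountingTerm L P → ℕ
  | .count _ _ _ φ => φ.br + 1
  | .int _ => 0
  | .add s t => max s.br t.br
  | .mul s t => max s.br t.br
  | .numVar _ => 0

end

mutual

/-- The binding width of a formula. -/
def Formula.bw : Formula L P → ℕ
  | .eq _ _ => 0
  | .rel _ _ => 0
  | .not φ => φ.bw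
  | .or φ ψ => max φ.bw ψ.bw
  | .exStr _ φ => max φ.bw 1
  | .pred _ ts => Finset.univ.sup fun i => (ts i).bw
  | .exNum _ φ => φ.bw

/-- The binding width of a counting term. -/
def CountingTerm.bw : CountingTerm L P → ℕ
  | .count k _ _ φ => max k φ.bw
  | .int _ => 0
  | .add s t => max s.bw t.bw
  | .mul s t => max s.bw t.bw
  | .numVar _ => 0

end

end SyntaxMeasures

section Semantics

variable {L : FirstOrder.Language.{u, v}} {P : NumPredCollection.{p}}
variable (A : Type w) [L.Structure A]

/-- The value of an argument of an atomic formula under an assignment of structure variables. -/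
def Arg.val (β : ℕ → A) : Arg L → A
  | Sum.inl x => β x
  | Sum.inr c => FirstOrder.Language.constantMap c

mutual

/-- `φ.Holds A β γ` says that `φ` is true in the structure `A` under the assignment `β` of structure
variables to elements and `γ` of number variables to integers. (`Function.extend y a β` maps `y j`
to `a j` and agrees with `β` elsewhere.) -/
noncomputable def Formula.Holds : Formula L P → (ℕ → A) → (ℕ → ℤ) → Prop
  | .eq s t, β, _ => Arg.val A β s = Arg.val A β t
  | .rel R ts, β, _ => FirstOrder.Language.Structure.RelMap R (fun i => Arg.val A β (ts i))
  | .not φ, β, γ => ¬ φ.Holds β γ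
  | .or φ ψ, β, γ => φ.Holds β γ ∨ ψ.Holds β γ
  | .exStr y φ, β, γ => ∃ a : A, φ.Holds (Function.update β y a) γ
  | .pred Q ts, β, γ => (fun i => (ts i).val β γ) ∈ P.sem Q
  | .exNum κ φ, β, γ => ∃ n : ℕ, n ≤ Nat.card A ∧ φ.Holds β (Function.update γ κ (n : ℤ))

/-- The integer value of a counting term. -/
noncomputable def CountingTerm.val : CountingTerm L P → (ℕ → A) → (ℕ → ℤ) → ℤ
  | .count k _ y φ, β, γ =>
      (Nat.card {a : Fin k → A // φ.Holds (Function.extend y a β) γ} : ℤ)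
  | .int i, _, _ => i
  | .add s t, β, γ => s.val β γ + t.val β γ
  | .mul s t, β, γ => s.val β γ * t.val β γ
  | .numVar κ, _, γ => γ κ

end

/-- `A ⊨ φ[a₁,…,aₖ]`, for a formula `φ(x₁,…,xₖ)`: the formula is true under the assignments that map
`xⱼ` to `aⱼ`. (When all free variables of `φ` are among the `xⱼ`, the values of the other variables
do not matter.) -/
def Formula.Sat (φ : Formula L P) {k : ℕ} (x : Fin k ↪ ℕ) (a : Fin k → A) : Prop :=
  ∀ (β : ℕ → A) (γ : ℕ → ℤ), (∀ j, β (x j) = a j) → φ.Holds A β γ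

end Semantics

section Locality

variable (L : FirstOrder.Language.{u, v})

/-- The Gaifman graph of a structure. -/
def gaifman (A : Type w) [L.Structure A] : SimpleGraph A where
  Adj a b := a ≠ b ∧ ∃ (n : ℕ) (R : L.Relations n) (t : Fin n → A),
    FirstOrder.Language.Structure.RelMap R t ∧ a ∈ Set.range t ∧ b ∈ Set.range t
  symm := ⟨by
    rintro a b ⟨hne, n, R, t, hR, ha, hb⟩
    exact ⟨hne.symm, n, R, t, hR, hb, ha⟩⟩
  loopless := ⟨fun _ h => h.1 rfl⟩

/-- The `r`-neighbourhood of a tuple: the elements at distance at most `r` from one of its entries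
in the Gaifman graph. -/
def nbhd {A : Type w} [L.Structure A] (r : ℕ) {n : ℕ} (a : Fin n → A) : Set A :=
  {b | ∃ i, (gaifman L A).edist (a i) b ≤ (r : ℕ∞)}

theorem mem_nbhd {A : Type w} [L.Structure A] (r : ℕ) {n : ℕ} (a : Fin n → A) (i : Fin n) :
    a i ∈ nbhd L r a :=
  ⟨i, by simp⟩

/-- The substructure induced on the `r`-neighbourhood of a tuple (the signature being relational,
every subset of a structure carries an induced substructure). -/
def sphere [L.IsRelational] {A : Type w} [L.Structure A] (r : ℕ) {n : ℕ} (a : Fin n → A) :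
    L.Substructure A where
  carrier := nbhd L r a
  fun_mem := fun f => isEmptyElim f

/-- The `r`-spheres of two tuples are isomorphic: some isomorphism of the induced substructures on
the `r`-neighbourhoods maps the `i`-th centre to the `i`-th centre. -/
def SphereIso [L.IsRelational] {A B : Type w} [L.Structure A] [L.Structure B] (r : ℕ) {n : ℕ}
    (a : Fin n → A) (b : Fin n → B) : Prop :=
  ∃ e : FirstOrder.Language.Equiv L (sphere L r a) (sphere L r b),
    ∀ i, e ⟨a i, mem_nbhd L r a i⟩ = ⟨b i, mem_nbhd L r b i⟩

/-- `(A, a)` and `(B, b)` are `r`-equivalent: there is a bijection `f : A → B` such that the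
`r`-spheres of `(a, c)` and of `(b, f c)` are isomorphic for all `c` in `A`. -/
def REquiv [L.IsRelational] {A B : Type w} [L.Structure A] [L.Structure B] (r : ℕ) {k : ℕ}
    (a : Fin k → A) (b : Fin k → B) : Prop :=
  ∃ f : A ≃ B, ∀ c : A,
    SphereIso L r (Fin.snoc (α := fun _ => A) a c) (Fin.snoc (α := fun _ => B) b (f c))

variable {L} {P : NumPredCollection.{p}}

/-- `φ(x₁,…,xₖ)` does not distinguish `r`-equivalent finite non-empty structures with `k`
distinguished elements. -/
def Formula.IsHanfLocalWith [L.IsRelational] (φ : Formula L P) {k : ℕ} (x : Fin k ↪ ℕ)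
    (r : ℕ) : Prop :=
  ∀ (A B : Type w) [L.Structure A] [L.Structure B] [Finite A] [Nonempty A] [Finite B] [Nonempty B]
    (a : Fin k → A) (b : Fin k → B), REquiv L r a b → (φ.Sat A x a ↔ φ.Sat B x b)

/-- `φ(x₁,…,xₖ)` is Hanf-local. -/
def Formula.IsHanfLocal [L.IsRelational] (φ : Formula L P) {k : ℕ} (x : Fin k ↪ ℕ) : Prop :=
  ∃ r : ℕ, IsHanfLocalWith.{u, v, w, p} φ x r

/-- The Hanf-locality rank of a Hanf-local formula `φ(x₁,…,xₖ)`: the minimal `r` as above. -/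
noncomputable def Formula.hanfRank [L.IsRelational] (φ : Formula L P) {k : ℕ} (x : Fin k ↪ ℕ) : ℕ :=
  sInf {r : ℕ | IsHanfLocalWith.{u, v, w, p} φ x r}

end Locality

end FOCN

-- Formulas and counting terms are treated by a simultaneous induction (`Formula.holds_iff`,
-- `CountingTerm.val_eq`) with the invariant `HanfEquiv`: the assigned elements have isomorphic
-- r-spheres, and some bijection of the universes preserves r-spheres of single elements. Predicates
-- see only values of counting terms, so their semantics is irrelevant; number quantifiers see only
-- the cardinality. The work lies in binding a k-tuple: `exists_tuple_equiv` finds a bijection of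
-- k-tuples that preserves the r-sphere of (a, c).
--
-- It is proved by induction on the tuple length. If no entry of c is near a, the balls around a and
-- c are separated, so only the sphere of c itself matters and isomorphisms glue
-- (`StrongBallIso.sumElim`). If an entry is near a, it lies in the (2r+1)-ball of a; the given
-- isomorphism dictates its image, and the other entries are matched by induction after adding it to
-- a. The bijections for the different positions combine by the least near position
-- (`exists_equiv_exists`). By finiteness, the leftover tuples of each isomorphism type are
-- equinumerous, which completes the bijection (`exists_equiv_extend`).
--
-- Each entry costs radius 2r+1, and one further unit makes isomorphisms respect the ambient Gaifman
-- graph. Thus binding k variables needs radius k(2r+1)+r+1, and for 1 ≤ k ≤ m this is covered by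
-- passing from (2m+1)^n - 1 to (2m+1)^(n+1) - 1.

namespace FOCN

open FirstOrder.Language.Structure (RelMap)

-- Isomorphisms of spheres around families

section BallEquiv

variable (L : FirstOrder.Language.{u, v}) {A B C : Type w} [L.Structure A] [L.Structure B]
  [L.Structure C] {ι κ : Type}

/-- The elements at Gaifman distance at most `r` from some member of a family. -/
def ball (r : ℕ) (a : ι → A) : Set A :=
  {b | ∃ i, (gaifman L A).edist (a i) b ≤ (r : ℕ∞)}

/-- The partial equivalence `e` is an isomorphism between the `r`-spheres of two families. -/
structure IsBallEquiv (r : ℕ) (a : ι → A) (b : ι → B) (e : PartialEquiv A B) : Prop where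
  source : e.source = ball L r a
  target : e.target = ball L r b
  center : ∀ i, e (a i) = b i
  rel : ∀ {n : ℕ} (R : L.Relations n) (t : Fin n → A), (∀ j, t j ∈ ball L r a) →
    (RelMap R (fun j => e (t j)) ↔ RelMap R t)

/-- An isomorphism of `r`-spheres that respects the adjacency of the ambient Gaifman graphs. -/
structure IsStrongBallEquiv (r : ℕ) (a : ι → A) (b : ι → B) (e : PartialEquiv A B) : Prop
    extends IsBallEquiv L r a b e where
  adj : ∀ {x y : A}, x ∈ ball L r a → y ∈ ball L r a →
    ((gaifman L B).Adj (e x) (e y) ↔ (gaifman L A).Adj x y)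

/-- The `r`-spheres of two families are isomorphic. -/
def BallIso (r : ℕ) (a : ι → A) (b : ι → B) : Prop :=
  ∃ e : PartialEquiv A B, IsBallEquiv L r a b e

/-- The `r`-spheres of two families are isomorphic, respecting ambient adjacency. -/
def StrongBallIso (r : ℕ) (a : ι → A) (b : ι → B) : Prop :=
  ∃ e : PartialEquiv A B, IsStrongBallEquiv L r a b e

variable {L}

theorem edist_le_succ_iff {V : Type*} {G : SimpleGraph V} {a b : V} {r : ℕ} :
    G.edist a b ≤ ((r + 1 : ℕ) : ℕ∞) ↔
      ∃ c, G.edist a c ≤ (r : ℕ∞) ∧ (c = b ∨ G.Adj c b) := by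
  constructor
  · intro h
    have hne : G.edist a b ≠ ⊤ := ne_top_of_le_ne_top (ENat.natCast_ne_top _) h
    obtain ⟨W, hW⟩ := SimpleGraph.exists_walk_of_edist_ne_top hne
    rw [← hW] at h
    have hl : W.length ≤ r + 1 := by exact_mod_cast h
    by_cases hz : W.length ≤ r
    · exact ⟨b, hW ▸ (by exact_mod_cast hz), Or.inl rfl⟩
    · have hlen : W.length = r + 1 := by omega
      refine ⟨W.getVert r, ?_, Or.inr ?_⟩
      · refine (SimpleGraph.edist_le (W.take r)).trans ?_
        rw [SimpleGraph.Walk.take_length]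
        exact_mod_cast Nat.min_le_left _ _
      · have := W.adj_getVert_succ (i := r) (by omega)
        rwa [← hlen, W.getVert_length] at this
  · rintro ⟨c, hc, rfl | hadj⟩
    · exact hc.trans (by exact_mod_cast Nat.le_succ r)
    · calc G.edist a b ≤ G.edist a c + G.edist c b := SimpleGraph.edist_triangle
        _ ≤ (r : ℕ∞) + 1 := add_le_add hc (SimpleGraph.edist_eq_one_iff_adj.2 hadj).le
        _ = ((r + 1 : ℕ) : ℕ∞) := by push_cast; rfl

theorem mem_ball {r : ℕ} {a : ι → A} {x : A} :
    x ∈ ball L r a ↔ ∃ i, (gaifman L A).edist (a i) x ≤ (r : ℕ∞) := Iff.rfl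

theorem self_mem_ball (r : ℕ) (a : ι → A) (i : ι) : a i ∈ ball L r a := ⟨i, by simp⟩

theorem mem_ball_of_edist_le {s q : ℕ} {a : ι → A} {x y : A} (hx : x ∈ ball L s a)
    (h : (gaifman L A).edist x y ≤ (q : ℕ∞)) : y ∈ ball L (s + q) a := by
  obtain ⟨i, hi⟩ := hx
  refine ⟨i, SimpleGraph.edist_triangle.trans ((add_le_add hi h).trans ?_)⟩
  push_cast; rfl

theorem ball_mono {r s : ℕ} (h : r ≤ s) (a : ι → A) : ball L r a ⊆ ball L s a :=
  fun _ ⟨i, hi⟩ => ⟨i, hi.trans (by exact_mod_cast h)⟩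

theorem mem_ball_of_adj {s : ℕ} {a : ι → A} {x y : A} (hx : x ∈ ball L s a)
    (h : (gaifman L A).Adj x y) : y ∈ ball L (s + 1) a :=
  mem_ball_of_edist_le hx (by simpa using (SimpleGraph.edist_eq_one_iff_adj.2 h).le)

theorem ball_subset_ball {s r ρ : ℕ} {a : ι → A} {a' : κ → A} (ha : ∀ j, a' j ∈ ball L s a)
    (h : s + r ≤ ρ) : ball L r a' ⊆ ball L ρ a :=
  fun _ ⟨j, hj⟩ => ball_mono h a (mem_ball_of_edist_le (ha j) hj)

theorem ball_sumElim (r : ℕ) (a : ι → A) (c : κ → A) :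
    ball L r (Sum.elim a c) = ball L r a ∪ ball L r c := by
  ext x; simp [mem_ball]

theorem ball_unit {r : ℕ} {c : κ → A} {x : A} :
    x ∈ ball L r c ↔ ∃ i, x ∈ ball L r (fun _ : Unit => c i) := by
  simp [mem_ball]

namespace IsBallEquiv

variable {r s q ρ : ℕ} {a : ι → A} {b : ι → B} {e : PartialEquiv A B}

theorem symm_center (h : IsBallEquiv L r a b e) (i : ι) : e.symm (b i) = a i := by
  rw [← h.center, e.left_inv]
  rw [h.source]; exact self_mem_ball r a i

theorem map_mem (h : IsBallEquiv L r a b e) {x : A} (hx : x ∈ ball L r a) :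
    e x ∈ ball L r b := by
  rw [← h.target]; exact e.map_source (h.source ▸ hx)

theorem injOn (h : IsBallEquiv L r a b e) : Set.InjOn e (ball L r a) := h.source ▸ e.injOn

theorem left_inv (h : IsBallEquiv L r a b e) {x : A} (hx : x ∈ ball L r a) :
    e.symm (e x) = x := e.left_inv (h.source ▸ hx)

theorem right_inv (h : IsBallEquiv L r a b e) {x : B} (hx : x ∈ ball L r b) :
    e (e.symm x) = x := e.right_inv (h.target ▸ hx)

theorem symm (h : IsBallEquiv L r a b e) : IsBallEquiv L r b a e.symm where
  source := h.target
  target := h.source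
  center := h.symm_center
  rel R t ht := by
    have hm : ∀ j, e.symm (t j) ∈ ball L r a := fun j => by
      rw [← h.source]; exact e.map_target (h.target ▸ ht j)
    rw [← h.rel R _ hm]
    simp only [fun j => h.right_inv (ht j)]

theorem trans {c : ι → C} {e' : PartialEquiv B C} (h : IsBallEquiv L r a b e)
    (h' : IsBallEquiv L r b c e') : IsBallEquiv L r a c (e.trans e') where
  source := by
    rw [PartialEquiv.trans_source, h'.source, ← h.target, ← h.source]
    exact Set.inter_eq_left.2 fun x hx => e.map_source hx
  target := by
    rw [PartialEquiv.trans_target, h.target, ← h'.source, ← h'.target]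
    exact Set.inter_eq_left.2 fun x hx => e'.map_target hx
  center i := by simp [h.center, h'.center]
  rel R t ht := by
    rw [← h.rel R t ht, ← h'.rel R _ fun j => h.map_mem (ht j)]
    rfl

/-- A tuple witnessing the adjacency consists of `x` and neighbours of `x`, so it lies in the `(s +
1)`-ball, where `e` preserves relations. -/
theorem adj_map (h : IsBallEquiv L ρ a b e) (hs : s + 1 ≤ ρ) {x y : A} (hx : x ∈ ball L s a)
    (hxy : (gaifman L A).Adj x y) : (gaifman L B).Adj (e x) (e y) := by
  obtain ⟨hne, n, R, t, hR, ⟨i, rfl⟩, ⟨j, rfl⟩⟩ := hxy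
  have ht : ∀ l, t l ∈ ball L ρ a := fun l => by
    by_cases hl : t i = t l
    · rw [← hl]; exact ball_mono (by omega) a hx
    · exact ball_mono hs a (mem_ball_of_adj hx ⟨hl, n, R, t, hR, ⟨i, rfl⟩, ⟨l, rfl⟩⟩)
  exact ⟨fun he => hne (h.injOn (ht i) (ht j) he), n, R, _, (h.rel R t ht).2 hR, ⟨i, rfl⟩,
    ⟨j, rfl⟩⟩

/-- Follow a short path: each edge starts strictly inside the `ρ`-ball, so `adj_map` applies to it.
-/
theorem edist_map (h : IsBallEquiv L ρ a b e) {x y : A} (hx : x ∈ ball L s a) (hs : s + q ≤ ρ)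
    (hxy : (gaifman L A).edist x y ≤ (q : ℕ∞)) :
    (gaifman L B).edist (e x) (e y) ≤ (q : ℕ∞) := by
  induction q generalizing y with
  | zero =>
    have : x = y := by simpa using hxy
    simp [this]
  | succ q ih =>
    obtain ⟨z, hz, hzy⟩ := edist_le_succ_iff.1 hxy
    refine edist_le_succ_iff.2 ⟨e z, ih (by omega) hz, ?_⟩
    rcases hzy with rfl | hzy
    · exact Or.inl rfl
    · exact Or.inr (h.adj_map (s := s + q) (by omega) (mem_ball_of_edist_le hx hz) hzy)

theorem map_mem_of_le (h : IsBallEquiv L ρ a b e) (hs : s ≤ ρ) {x : A} (hx : x ∈ ball L s a) :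
    e x ∈ ball L s b := by
  obtain ⟨i, hi⟩ := hx
  exact ⟨i, h.center i ▸ h.edist_map (s := 0) (self_mem_ball 0 a i) (by omega) hi⟩

/-- By `edist_map` for `e` and for its inverse, the smaller balls correspond exactly. -/
theorem restr (h : IsBallEquiv L ρ a b e) {a' : κ → A} (ha : ∀ j, a' j ∈ ball L s a)
    (hs : s + r ≤ ρ) : IsBallEquiv L r a' (fun j => e (a' j)) (e.restr (ball L r a')) := by
  have hsub : ball L r a' ⊆ ball L ρ a := ball_subset_ball ha hs
  have ha' : ∀ j, e (a' j) ∈ ball L s b := fun j => h.map_mem_of_le (by omega) (ha j)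
  have hinv : ∀ j, e.symm (e (a' j)) = a' j := fun j => h.left_inv (ball_mono (by omega) a (ha j))
  refine ⟨?_, ?_, fun _ => rfl, fun R t ht => h.rel R t fun j => hsub (ht j)⟩
  · rw [PartialEquiv.restr_source, h.source, Set.inter_eq_right]
    exact hsub
  · rw [PartialEquiv.restr_target, h.target]
    ext y
    constructor
    · rintro ⟨hy, j, hj⟩
      refine ⟨j, ?_⟩
      have := h.edist_map (ha j) hs hj
      rwa [h.right_inv hy] at this
    · rintro ⟨j, hj⟩
      refine ⟨ball_subset_ball ha' hs ⟨j, hj⟩, j, ?_⟩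
      have := h.symm.edist_map (ha' j) hs hj
      rwa [hinv] at this

/-- Two boundary elements of an `r`-ball may be adjacent through a tuple that leaves the ball, but
that tuple stays within radius `r + 1`. This accounts for the extra unit of radius in each binding
step. -/
theorem strong (h : IsBallEquiv L (r + 1) a b e) :
    IsStrongBallEquiv L r a b (e.restr (ball L r a)) := by
  have h' := h.restr (r := r) (s := 0) (self_mem_ball 0 a) (by omega)
  simp only [h.center] at h'
  refine ⟨h', fun {x y} hx hy => ⟨fun hxy => ?_, h.adj_map le_rfl hx⟩⟩
  have := h.symm.adj_map le_rfl (h.map_mem_of_le (by omega) hx) hxy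
  rwa [h.left_inv (ball_mono (by omega) a hx), PartialEquiv.restr_coe,
    h.left_inv (ball_mono (by omega) a hy)] at this

end IsBallEquiv

namespace IsStrongBallEquiv

variable {r s ρ : ℕ} {a : ι → A} {b : ι → B} {e : PartialEquiv A B}

theorem symm (h : IsStrongBallEquiv L r a b e) : IsStrongBallEquiv L r b a e.symm where
  toIsBallEquiv := h.toIsBallEquiv.symm
  adj hx hy := by
    rw [← h.adj (h.toIsBallEquiv.symm.map_mem hx) (h.toIsBallEquiv.symm.map_mem hy),
      h.right_inv hx, h.right_inv hy]

theorem trans {c : ι → C} {e' : PartialEquiv B C} (h : IsStrongBallEquiv L r a b e)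
    (h' : IsStrongBallEquiv L r b c e') : IsStrongBallEquiv L r a c (e.trans e') where
  toIsBallEquiv := h.toIsBallEquiv.trans h'.toIsBallEquiv
  adj hx hy := by
    rw [← h.adj hx hy, ← h'.adj (h.map_mem hx) (h.map_mem hy)]
    rfl

theorem restr (h : IsStrongBallEquiv L ρ a b e) {a' : κ → A} (ha : ∀ j, a' j ∈ ball L s a)
    (hs : s + r ≤ ρ) : IsStrongBallEquiv L r a' (fun j => e (a' j)) (e.restr (ball L r a')) where
  toIsBallEquiv := h.toIsBallEquiv.restr ha hs
  adj hx hy := h.adj (ball_subset_ball ha hs hx) (ball_subset_ball ha hs hy)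

end IsStrongBallEquiv

theorem BallIso.reindex {r s : ℕ} {a : ι → A} {b : ι → B} (h : BallIso L s a b) (hrs : r ≤ s)
    {a' : κ → A} {b' : κ → B} (g : κ → ι) (ha : ∀ j, a' j = a (g j)) (hb : ∀ j, b' j = b (g j)) :
    BallIso L r a' b' := by
  obtain ⟨e, he⟩ := h
  obtain rfl : a' = fun j => a (g j) := funext ha
  obtain rfl : b' = fun j => b (g j) := funext hb
  have := he.restr (r := r) (s := 0) (fun j => self_mem_ball 0 a (g j)) (by omega)
  simp only [he.center] at this
  exact ⟨_, this⟩

theorem BallIso.strong {r : ℕ} {a : ι → A} {b : ι → B} (h : BallIso L (r + 1) a b) :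
    StrongBallIso L r a b :=
  ⟨_, h.choose_spec.strong⟩

namespace StrongBallIso

variable {r s : ℕ} {a : ι → A} {b : ι → B}

theorem ballIso (h : StrongBallIso L r a b) : BallIso L r a b :=
  ⟨_, h.choose_spec.toIsBallEquiv⟩

theorem symm (h : StrongBallIso L r a b) : StrongBallIso L r b a := ⟨_, h.choose_spec.symm⟩

theorem trans {c : ι → C} (h : StrongBallIso L r a b) (h' : StrongBallIso L r b c) :
    StrongBallIso L r a c := ⟨_, h.choose_spec.trans h'.choose_spec⟩

theorem reindex (h : StrongBallIso L s a b) (hrs : r ≤ s)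
    {a' : κ → A} {b' : κ → B} (g : κ → ι) (ha : ∀ j, a' j = a (g j)) (hb : ∀ j, b' j = b (g j)) :
    StrongBallIso L r a' b' := by
  obtain ⟨e, he⟩ := h
  obtain rfl : a' = fun j => a (g j) := funext ha
  obtain rfl : b' = fun j => b (g j) := funext hb
  have := he.restr (r := r) (s := 0) (fun j => self_mem_ball 0 a (g j)) (by omega)
  simp only [he.center] at this
  exact ⟨_, this⟩

end StrongBallIso

-- Nearness, and gluing of separated spheres

variable (L) in
/-- The `r`-balls around a family and around a single element intersect or are adjacent. -/
def Near (r : ℕ) (a : ι → A) (x : A) : Prop :=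
  ∃ y ∈ ball L r a, ∃ z ∈ ball L r (fun _ : Unit => x), y = z ∨ (gaifman L A).Adj y z

theorem Near.mem_ball {r : ℕ} {a : ι → A} {x : A} (h : Near L r a x) :
    x ∈ ball L (2 * r + 1) a := by
  obtain ⟨y, hy, z, ⟨_, hz⟩, hyz⟩ := h
  have hz' : z ∈ ball L (r + 1) a := by
    rcases hyz with rfl | hyz
    · exact ball_mono (by omega) a hy
    · exact mem_ball_of_adj hy hyz
  exact ball_mono (by omega) a (mem_ball_of_edist_le hz' (SimpleGraph.edist_comm.trans_le hz))

/-- The witnesses lie in the two `r`-balls, so they can be transported; a connecting edge survives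
because a strong isomorphism respects ambient adjacency. -/
theorem Near.map {r : ℕ} {a : ι → A} {b : ι → B} {x : A} {y : B}
    (h : StrongBallIso L r (Sum.elim a fun _ : Unit => x) (Sum.elim b fun _ : Unit => y))
    (hx : Near L r a x) : Near L r b y := by
  obtain ⟨e, he⟩ := h
  obtain ⟨z, ⟨i, hz⟩, z', ⟨_, hz'⟩, hzz⟩ := hx
  have hmem : ∀ i, Sum.elim a (fun _ : Unit => x) i ∈ ball L 0 (Sum.elim a fun _ : Unit => x) :=
    self_mem_ball 0 _
  refine ⟨e z, ⟨i, ?_⟩, e z', ⟨(), ?_⟩, ?_⟩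
  · rw [← show _ = b i from he.center (Sum.inl i)]
    exact he.edist_map (hmem (Sum.inl i)) (by omega) hz
  · rw [← show _ = y from he.center (Sum.inr ())]
    exact he.edist_map (hmem (Sum.inr ())) (by omega) hz'
  · rcases hzz with rfl | hzz
    · exact Or.inl rfl
    · exact Or.inr ((he.adj ⟨Sum.inl i, hz⟩ ⟨Sum.inr (), hz'⟩).2 hzz)

theorem near_iff {r : ℕ} {a : ι → A} {b : ι → B} {x : A} {y : B}
    (h : StrongBallIso L r (Sum.elim a fun _ : Unit => x) (Sum.elim b fun _ : Unit => y)) :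
    Near L r a x ↔ Near L r b y :=
  ⟨Near.map h, Near.map h.symm⟩

/-- If no member of `c` is near `a`, then the balls around `a` and `c` are disjoint and not
joined by an edge of the Gaifman graph. -/
theorem separated_of_not_near {r : ℕ} {a : ι → A} {c : κ → A} (h : ∀ i, ¬ Near L r a (c i))
    {x y : A} (hx : x ∈ ball L r a) (hy : y ∈ ball L r c) :
    x ≠ y ∧ ¬ (gaifman L A).Adj x y := by
  obtain ⟨i, hi⟩ := ball_unit.1 hy
  exact ⟨fun hxy => h i ⟨x, hx, y, hi, Or.inl hxy⟩, fun hxy => h i ⟨x, hx, y, hi, Or.inr hxy⟩⟩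

/-- A tuple of a relation that lies in two separated balls lies in one of them. -/
theorem tuple_mem_of_not_near {r : ℕ} {a : ι → A} {c : κ → A} (h : ∀ i, ¬ Near L r a (c i))
    {n : ℕ} {R : L.Relations n} {t : Fin n → A} (hR : RelMap R t)
    (ht : ∀ j, t j ∈ ball L r a ∪ ball L r c) :
    (∀ j, t j ∈ ball L r a) ∨ ∀ j, t j ∈ ball L r c := by
  by_contra! hcon
  obtain ⟨⟨j, hj⟩, ⟨l, hl⟩⟩ := hcon
  have hj' := (ht j).resolve_left hj
  have hl' := (ht l).resolve_right hl
  obtain ⟨hne, hadj⟩ := separated_of_not_near h hl' hj'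
  exact hadj ⟨hne, n, R, t, hR, ⟨l, rfl⟩, ⟨j, rfl⟩⟩

/-- Isomorphisms between separated balls can be glued. -/
theorem StrongBallIso.sumElim {r : ℕ} {a : ι → A} {c : κ → A} {b : ι → B} {d : κ → B}
    (hab : StrongBallIso L r a b) (hcd : StrongBallIso L r c d)
    (hA : ∀ i, ¬ Near L r a (c i)) (hB : ∀ i, ¬ Near L r b (d i)) :
    StrongBallIso L r (Sum.elim a c) (Sum.elim b d) := by
  classical
  obtain ⟨e, he⟩ := hab
  obtain ⟨e', he'⟩ := hcd
  have hs : Disjoint e.source e'.source := by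
    rw [he.source, he'.source, Set.disjoint_left]
    exact fun x hx hx' => (separated_of_not_near hA hx hx').1 rfl
  have ht : Disjoint e.target e'.target := by
    rw [he.target, he'.target, Set.disjoint_left]
    exact fun x hx hx' => (separated_of_not_near hB hx hx').1 rfl
  let g := e.disjointUnion e' hs ht
  have g1 : ∀ x ∈ ball L r a, g x = e x := fun x hx =>
    Set.piecewise_eq_of_mem e.source e e' (he.source ▸ hx)
  have g2 : ∀ x ∈ ball L r c, g x = e' x := fun x hx =>
    Set.piecewise_eq_of_notMem e.source e e' (hs.notMem_of_mem_right (he'.source ▸ hx))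
  have pure_iff : ∀ {n : ℕ} (R : L.Relations n) (t : Fin n → A),
      ((∀ j, t j ∈ ball L r a) ∨ ∀ j, t j ∈ ball L r c) →
      (RelMap R (fun j => g (t j)) ↔ RelMap R t) := by
    rintro n R t (h | h)
    · rw [← he.rel R t h]; simp only [fun j => g1 _ (h j)]
    · rw [← he'.rel R t h]; simp only [fun j => g2 _ (h j)]
  refine ⟨g, ⟨?_, ?_, ?_, ?_⟩, ?_⟩
  · rw [ball_sumElim, ← he.source, ← he'.source]; rfl
  · rw [ball_sumElim, ← he.target, ← he'.target]; rfl
  · rintro (i | i)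
    · exact (g1 _ (self_mem_ball r a i)).trans (he.center i)
    · exact (g2 _ (self_mem_ball r c i)).trans (he'.center i)
  · intro n R t ht
    rw [ball_sumElim] at ht
    refine ⟨fun h => ?_, fun h => (pure_iff R t (tuple_mem_of_not_near hA h ht)).2 h⟩
    -- By separation in `B` the image tuple lies in one ball; disjointness of the two image balls
    -- pulls this back to `t`.
    refine (pure_iff R t ?_).1 h
    have hgt : ∀ j, g (t j) ∈ ball L r b ∪ ball L r d := fun j => (ht j).imp
      (fun hj => g1 _ hj ▸ he.map_mem hj) (fun hj => g2 _ hj ▸ he'.map_mem hj)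
    refine (tuple_mem_of_not_near hB h hgt).imp (fun h' j => ?_) (fun h' j => ?_)
    · refine (ht j).resolve_right fun hj => ?_
      exact (separated_of_not_near hB (h' j) (g2 _ hj ▸ he'.map_mem hj)).1 rfl
    · refine (ht j).resolve_left fun hj => ?_
      exact (separated_of_not_near hB (g1 _ hj ▸ he.map_mem hj) (h' j)).1 rfl
  · intro x y hx hy
    rw [ball_sumElim] at hx hy
    rcases hx with hx | hx <;> rcases hy with hy | hy
    · rw [g1 _ hx, g1 _ hy, he.adj hx hy]
    · rw [g1 _ hx, g2 _ hy]
      exact iff_of_false (separated_of_not_near hB (he.map_mem hx) (he'.map_mem hy)).2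
        (separated_of_not_near hA hx hy).2
    · rw [g2 _ hx, g1 _ hy, SimpleGraph.adj_comm, SimpleGraph.adj_comm _ x]
      exact iff_of_false (separated_of_not_near hB (he.map_mem hy) (he'.map_mem hx)).2
        (separated_of_not_near hA hy hx).2
    · rw [g2 _ hx, g2 _ hy, he'.adj hx hy]

end BallEquiv

-- Matching finite sets

section Matching

variable {X Y : Type w} {T : Type*}

/-- Cancellation of finite cardinals: in each fibre both the whole and the part cut out by `P` or
`Q` are equinumerous, hence so are the complements. -/
theorem exists_equiv_compl_of_fibers [Finite X] [Finite Y] {u : X → T} {v : Y → T} (F : X ≃ Y)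
    (hF : ∀ x, v (F x) = u x) {P : X → Prop} {Q : Y → Prop} (G : {x // P x} ≃ {y // Q y})
    (hG : ∀ x : {x // P x}, v (G x) = u x) :
    ∃ H : {x // ¬ P x} ≃ {y // ¬ Q y}, ∀ x : {x // ¬ P x}, v (H x) = u x := by
  classical
  have split {Z : Type w} [Finite Z] (w : Z → T) (R : Z → Prop) (t : T) :
      Nat.card {z // w z = t} = Nat.card {z : {z // R z} // w z = t} +
        Nat.card {z : {z // ¬ R z} // w z = t} := by
    rw [← Nat.card_sum]
    refine Nat.card_congr (Equiv.trans ?_ (Equiv.subtypeSum (p := fun s =>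
      w (Equiv.sumCompl R s) = t)))
    exact ((Equiv.sumCompl R).subtypeEquiv fun _ => Iff.rfl).symm
  have fib (t : T) : Nonempty ({x : {x // ¬ P x} // u x = t} ≃ {y : {y // ¬ Q y} // v y = t}) := by
    refine ⟨(Finite.card_eq.1 ?_).some⟩
    have h1 := split u P t
    have h2 := split v Q t
    have h3 : Nat.card {x // u x = t} = Nat.card {y // v y = t} :=
      Nat.card_congr (F.subtypeEquiv fun x => by rw [hF])
    have h4 : Nat.card {x : {x // P x} // u x = t} = Nat.card {y : {y // Q y} // v y = t} :=
      Nat.card_congr (G.subtypeEquiv fun x => by rw [hG])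
    omega
  refine ⟨(Equiv.sigmaFiberEquiv fun x : {x // ¬ P x} => u x).symm.trans
    ((Equiv.sigmaCongrRight fun t => (fib t).some).trans
      (Equiv.sigmaFiberEquiv fun y : {y // ¬ Q y} => v y)), fun x => ?_⟩
  exact ((fib (u x)).some ⟨x, rfl⟩).2

variable {rel : X → Y → Prop}

/-- A partial bijection within a difunctional relation that contains a bijection extends to a
bijection within that relation. -/
theorem exists_equiv_extend [Finite X] [Finite Y]
    (hrel : ∀ {x x' y y'}, rel x y → rel x' y → rel x' y' → rel x y') (F : X ≃ Y)
    (hF : ∀ x, rel x (F x)) {P : X → Prop} {Q : Y → Prop} (G : {x // P x} ≃ {y // Q y})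
    (hG : ∀ x : {x // P x}, rel x (G x)) :
    ∃ K : X ≃ Y, (∀ x (hx : P x), K x = G ⟨x, hx⟩) ∧ ∀ x, ¬ P x → ¬ Q (K x) ∧ rel x (K x) := by
  classical
  -- Rows of a difunctional relation are equal or disjoint, so the row of `x` labels `x`, and the
  -- union of the rows through `y` labels `y`.
  have key {x : X} {y : Y} (h : rel x y) : {y' | ∃ x, rel x y ∧ rel x y'} = {y' | rel x y'} := by
    ext y'
    exact ⟨fun ⟨x', h1, h2⟩ => hrel h h1 h2, fun h' => ⟨x, h, h'⟩⟩
  obtain ⟨H, hH⟩ := exists_equiv_compl_of_fibers (u := fun x => {y' | rel x y'})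
    (v := fun y => {y' | ∃ x, rel x y ∧ rel x y'}) F (fun x => key (hF x)) G
    (fun x => key (hG x))
  have hH' (x : {x // ¬ P x}) : rel x (H x) := by
    -- Since `F` is onto, `H x` belongs to its own label, which is the row of `x`.
    have h : rel (F.symm (H x)) (H x) := by simpa using hF (F.symm (H x))
    exact (Set.ext_iff.1 (hH x) (H x)).1 ⟨_, h, h⟩
  refine ⟨(Equiv.sumCompl P).symm.trans ((Equiv.sumCongr G H).trans (Equiv.sumCompl Q)),
    fun x hx => ?_, fun x hx => ?_⟩
  · simp [Equiv.sumCompl_symm_apply_of_pos hx]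
  · simp only [Equiv.trans_apply, Equiv.sumCompl_symm_apply_of_neg hx, Equiv.sumCongr_apply,
      Sum.map_inr, Equiv.sumCompl_apply_inr]
    exact ⟨(H ⟨x, hx⟩).2, hH' ⟨x, hx⟩⟩

/-- Bijections that respect a family of properties wherever the `i`-th property holds assemble, by
the least index of a property that holds, to a bijection between the unions. -/
theorem exists_equiv_exists {n : ℕ} {p : X → Fin n → Prop} {q : Y → Fin n → Prop}
    (hrel : ∀ {x y}, rel x y → ∀ j, p x j ↔ q y j) (G : Fin n → X ≃ Y)
    (hG : ∀ x i, p x i ∨ q (G i x) i → rel x (G i x)) :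
    ∃ K : {x // ∃ i, p x i} ≃ {y // ∃ i, q y i}, ∀ x : {x // ∃ i, p x i}, rel x (K x) := by
  classical
  have least {Z : Type w} (s : Z → Fin n → Prop) : Function.Bijective
      (fun z : Σ i, {z // s z i ∧ ∀ j < i, ¬ s z j} =>
        (⟨z.2.1, z.1, z.2.2.1⟩ : {z // ∃ i, s z i})) := by
    constructor
    · rintro ⟨i, z, h, h'⟩ ⟨j, z', k, k'⟩ hz
      obtain rfl : z = z' := congrArg Subtype.val hz
      obtain rfl : i = j := by
        rcases lt_trichotomy i j with hij | hij | hij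
        · exact absurd h (k' i hij)
        · exact hij
        · exact absurd k (h' j hij)
      rfl
    · rintro ⟨z, hz⟩
      obtain ⟨i, hi, hmin⟩ := WellFounded.has_min (wellFounded_lt (α := Fin n)) {i | s z i} hz
      exact ⟨⟨i, z, hi, fun j hj hs => hmin j hs hj⟩, rfl⟩
  -- `hG` also applies when only the image has the `i`-th property; hence `i` is the least index for
  -- `x` exactly when it is for `G i x`.
  have hG' (i : Fin n) (x : X) :
      (p x i ∧ ∀ j < i, ¬ p x j) ↔ (q (G i x) i ∧ ∀ j < i, ¬ q (G i x) j) := by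
    by_cases h : p x i ∨ q (G i x) i
    · simp only [hrel (hG x i h)]
    · exact iff_of_false (fun h' => h (Or.inl h'.1)) (fun h' => h (Or.inr h'.1))
  let K := (Equiv.ofBijective _ (least p)).symm.trans ((Equiv.sigmaCongrRight fun i =>
    (G i).subtypeEquiv (hG' i)).trans (Equiv.ofBijective _ (least q)))
  refine ⟨K, fun x => ?_⟩
  obtain ⟨⟨i, x, hx⟩, rfl⟩ := (Equiv.ofBijective _ (least p)).surjective x
  simp only [K, Equiv.trans_apply, Equiv.symm_apply_apply]
  exact hG x i (Or.inl hx.1)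

end Matching

-- Matching tuples over a family

section TupleEquiv

variable {L : FirstOrder.Language.{u, v}} {A B : Type w} [L.Structure A] [L.Structure B]
  {ι : Type}

theorem difunctional_strongBallIso {r : ℕ} {a a' : ι → A} {b b' : ι → B}
    (h : StrongBallIso L r a b) (h' : StrongBallIso L r a' b) (h'' : StrongBallIso L r a' b') :
    StrongBallIso L r a b' :=
  (h.trans h'.symm).trans h''

/-- An isomorphism of spheres extends to a bijection of the universes. -/
theorem IsBallEquiv.exists_equiv [Finite A] [Finite B] {s ρ : ℕ} {a : ι → A} {b : ι → B}
    {e : PartialEquiv A B} (he : IsBallEquiv L ρ a b e) (hs : s ≤ ρ) (f : A ≃ B) :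
    ∃ H : A ≃ B, (∀ x ∈ ball L s a, H x = e x) ∧ ∀ x, H x ∈ ball L s b → x ∈ ball L s a := by
  let G : {x // x ∈ ball L s a} ≃ {y // y ∈ ball L s b} :=
    { toFun x := ⟨e x, he.map_mem_of_le hs x.2⟩
      invFun y := ⟨e.symm y, he.symm.map_mem_of_le hs y.2⟩
      left_inv x := Subtype.ext (he.left_inv (ball_mono hs a x.2))
      right_inv y := Subtype.ext (he.right_inv (ball_mono hs b y.2)) }
  obtain ⟨H, h1, h2⟩ := exists_equiv_extend (rel := fun _ _ => True) (by simp) f (by simp) G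
    (by simp)
  exact ⟨H, h1, fun x hx => by_contra fun h => (h2 x h).1 hx⟩

/-- If `r`-equivalence with a suitable larger radius holds, then tuples of length `m` can be matched
such that the `r`-spheres of the families extended by these tuples are isomorphic. -/
theorem exists_tuple_equiv [Finite A] [Finite B] (r m : ℕ) (f : A ≃ B)
    (hf : ∀ c, StrongBallIso L (m * (2 * r + 1) + r) (fun _ : Unit => c) (fun _ => f c))
    (a : ι → A) (b : ι → B) (hab : StrongBallIso L (m * (2 * r + 1) + r) a b) :
    ∃ F : (Fin m → A) ≃ (Fin m → B),
      ∀ c, StrongBallIso L r (Sum.elim a c) (Sum.elim b (F c)) := by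
  classical
  -- The family must vary: the hypothesis is used over a single element and over `a` with one
  -- element added.
  induction m generalizing ι with
  | zero =>
    refine ⟨Equiv.ofUnique _ _, fun c => ?_⟩
    exact hab.reindex (by omega) (Sum.elim id Fin.elim0) (by rintro (i | i); rfl; exact i.elim0)
      (by rintro (i | i); rfl; exact i.elim0)
  | succ m ih =>
    have hle : m * (2 * r + 1) + r ≤ (m + 1) * (2 * r + 1) + r := by nlinarith
    have ih' {κ : Type} := @ih κ fun c => (hf c).reindex hle id (fun _ => rfl) (fun _ => rfl)
    -- Disregarding `a`: match the first entry by `f`, and the rest over that entry.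
    have total : ∃ F : (Fin (m + 1) → A) ≃ (Fin (m + 1) → B),
        ∀ c, StrongBallIso L r c (F c) := by
      choose F hF using fun c : A => ih' (fun _ : Unit => c) (fun _ => f c)
        ((hf c).reindex hle id (fun _ => rfl) (fun _ => rfl))
      refine ⟨(Fin.consEquiv fun _ => A).symm.trans
        ((Equiv.prodShear f F).trans (Fin.consEquiv fun _ => B)), fun c => ?_⟩
      refine (hF (c 0) (Fin.tail c)).reindex le_rfl
        (Fin.cons (Sum.inl ()) Sum.inr : Fin (m + 1) → Unit ⊕ Fin m) (fun j => ?_) (fun j => ?_)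
      · refine Fin.cases ?_ (fun j => ?_) j <;> rfl
      · refine Fin.cases ?_ (fun j => ?_) j <;> rfl
    -- Match the `i`-th entry by an extension `H` of the given isomorphism on the `(2 * r +
    -- 1)`-ball, and the rest over the enlarged family.
    have near (i : Fin (m + 1)) : ∃ G : (Fin (m + 1) → A) ≃ (Fin (m + 1) → B),
        ∀ c, Near L r a (c i) ∨ Near L r b (G c i) →
          StrongBallIso L r (Sum.elim a c) (Sum.elim b (G c)) := by
      obtain ⟨e, he⟩ := hab
      obtain ⟨H, hH, hH'⟩ := he.exists_equiv (s := 2 * r + 1) (by nlinarith) f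
      have hF (x : A) : ∃ F : (Fin m → A) ≃ (Fin m → B), x ∈ ball L (2 * r + 1) a →
          ∀ c, StrongBallIso L r (Sum.elim (Sum.elim a fun _ : Unit => x) c)
            (Sum.elim (Sum.elim b fun _ : Unit => H x) (F c)) := by
        by_cases hx : x ∈ ball L (2 * r + 1) a
        · have hmem : ∀ j, Sum.elim a (fun _ : Unit => x) j ∈ ball L (2 * r + 1) a := by
            rintro (j | j)
            · exact self_mem_ball _ a j
            · exact hx
          -- The added element uses up `2 * r + 1` of the radius, leaving exactly what the induction
          -- hypothesis requires.
          have h := he.restr (r := m * (2 * r + 1) + r) hmem (by nlinarith)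
          have heq : (fun j => e (Sum.elim a (fun _ : Unit => x) j)) =
              Sum.elim b fun _ : Unit => H x := by
            funext j
            rcases j with j | j
            · exact he.center j
            · exact (hH x hx).symm
          rw [heq] at h
          obtain ⟨F, hF⟩ := ih' _ _ ⟨_, h⟩
          exact ⟨F, fun _ => hF⟩
        -- A filler outside the ball, needed only to obtain a bijection on all tuples.
        · exact ⟨Equiv.arrowCongr (Equiv.refl _) f, fun h => absurd h hx⟩
      choose F hF using hF
      refine ⟨(Fin.insertNthEquiv (fun _ => A) i).symm.trans
        ((Equiv.prodShear H F).trans (Fin.insertNthEquiv (fun _ => B) i)), fun c hc => ?_⟩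
      have hci : c i ∈ ball L (2 * r + 1) a := by
        rcases hc with hc | hc
        · exact hc.mem_ball
        -- For nearness on the side of `B`: `H` sends nothing from outside into the ball of `b`.
        · refine hH' _ ?_
          have := hc.mem_ball
          simpa using this
      refine (hF (c i) hci (i.removeNth c)).reindex le_rfl
        (Sum.elim (Sum.inl ∘ Sum.inl) (Fin.insertNth i (Sum.inl (Sum.inr ())) Sum.inr) :
          ι ⊕ Fin (m + 1) → (ι ⊕ Unit) ⊕ Fin m) ?_ ?_
      · rintro (j | j)
        · rfl
        · refine Fin.succAboveCases i ?_ (fun j => ?_) j <;> simp [Fin.removeNth]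
      · rintro (j | j)
        · rfl
        · refine Fin.succAboveCases i ?_ (fun j => ?_) j <;> simp
    have near_of {x : Fin (m + 1) → A} {y : Fin (m + 1) → B}
        (h : StrongBallIso L r (Sum.elim a x) (Sum.elim b y)) (j : Fin (m + 1)) :
        Near L r a (x j) ↔ Near L r b (y j) :=
      near_iff (h.reindex le_rfl (Sum.elim Sum.inl fun _ => Sum.inr j)
        (by rintro (i | i) <;> rfl) (by rintro (i | i) <;> rfl))
    choose G hG using near
    obtain ⟨K, hK⟩ := exists_equiv_exists (rel := fun x y => StrongBallIso L r (Sum.elim a x) (Sum.elim b y))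
      (p := fun c i => Near L r a (c i)) (q := fun c i => Near L r b (c i)) near_of G fun c i => hG i c
    obtain ⟨F₀, hF₀⟩ := total
    -- Leftover tuples need only match in their own spheres; `F₀` supplies the total count of each
    -- type and `K` the count already used.
    obtain ⟨F, h1, h2⟩ := exists_equiv_extend (rel := fun x y => StrongBallIso L r x y)
      difunctional_strongBallIso F₀ hF₀ K
      (fun x => (hK x).reindex le_rfl Sum.inr (fun _ => rfl) (fun _ => rfl))
    refine ⟨F, fun c => ?_⟩
    by_cases hc : ∃ i, Near L r a (c i)
    · rw [h1 c hc]; exact hK ⟨c, hc⟩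
    · obtain ⟨h3, h4⟩ := h2 c hc
      exact (hab.reindex (by omega) id (fun _ => rfl) (fun _ => rfl)).sumElim h4
        (not_exists.1 hc) (not_exists.1 h3)

end TupleEquiv

-- Invariance of formulas and counting terms

section Invariance

variable {L : FirstOrder.Language.{u, v}} {P : NumPredCollection.{p}} {A B : Type w}
  [L.Structure A] [L.Structure B] {ι κ : Type}

variable (L) in
/-- The `r`-spheres of two families are isomorphic, and the universes can be matched such that
corresponding elements have isomorphic `r`-spheres. -/
def HanfEquiv (r : ℕ) (a : ι → A) (b : ι → B) : Prop :=
  BallIso L r a b ∧ ∃ f : A ≃ B, ∀ c, BallIso L r (fun _ : Unit => c) (fun _ => f c)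

/-- The bijection of single elements does not refer to the family, so the same `f` survives the step
with a smaller radius. -/
theorem HanfEquiv.exists_tuple_equiv [Finite A] [Finite B] {r s k : ℕ} {a : ι → A} {b : ι → B}
    (h : HanfEquiv L s a b) (hs : k * (2 * r + 1) + r + 1 ≤ s) :
    ∃ F : (Fin k → A) ≃ (Fin k → B), ∀ c, HanfEquiv L r (Sum.elim a c) (Sum.elim b (F c)) := by
  obtain ⟨hab, f, hf⟩ := h
  obtain ⟨F, hF⟩ := FOCN.exists_tuple_equiv r k f
    (fun c => ((hf c).reindex hs id (fun _ => rfl) (fun _ => rfl)).strong) a b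
    (hab.reindex hs id (fun _ => rfl) (fun _ => rfl)).strong
  have hrs : r ≤ s := le_trans (by omega) hs
  exact ⟨F, fun c => ⟨(hF c).ballIso, f, fun c =>
    (hf c).reindex hrs id (fun _ => rfl) (fun _ => rfl)⟩⟩

theorem HanfEquiv.reindex {r : ℕ} {a : ι → A} {b : ι → B} (h : HanfEquiv L r a b)
    {a' : κ → A} {b' : κ → B} (g : κ → ι) (ha : ∀ j, a' j = a (g j)) (hb : ∀ j, b' j = b (g j)) :
    HanfEquiv L r a' b' :=
  ⟨h.1.reindex le_rfl g ha hb, h.2⟩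

/-- One step of binding `k` variables, in terms of assignments. -/
theorem HanfEquiv.exists_extend_equiv [Finite A] [Finite B] {m n k : ℕ} (hk : 0 < k) (hkm : k ≤ m)
    {V : Set ℕ} {β : ℕ → A} {β' : ℕ → B} (y : Fin k ↪ ℕ)
    (h : HanfEquiv L ((2 * m + 1) ^ (n + 1) - 1) (fun i : V => β i) (fun i : V => β' i)) :
    ∃ F : (Fin k → A) ≃ (Fin k → B), ∀ c, HanfEquiv L ((2 * m + 1) ^ n - 1)
      (fun i : (V ∪ Set.range y : Set ℕ) => Function.extend y c β i)
      (fun i => Function.extend y (F c) β' i) := by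
  classical
  -- With `(2 * m + 1) ^ n = r + 1` and `k` replaced by `m`, the two sides differ by `m - 1`; this
  -- is where `0 < k ≤ m` enters.
  have hr : k * (2 * ((2 * m + 1) ^ n - 1) + 1) + ((2 * m + 1) ^ n - 1) + 1 ≤
      (2 * m + 1) ^ (n + 1) - 1 := by
    obtain ⟨r, hr⟩ : ∃ r, (2 * m + 1) ^ n = r + 1 :=
      ⟨_, (Nat.succ_pred_eq_of_pos (by positivity)).symm⟩
    rw [pow_succ, hr, Nat.add_sub_cancel]
    refine Nat.le_sub_of_add_le ?_
    nlinarith [Nat.mul_le_mul_right (2 * r + 1) hkm]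
  obtain ⟨F, hF⟩ := h.exists_tuple_equiv hr
  -- A bound variable may shadow one in `V`; its value then comes from the tuple.
  have hg (i : (V ∪ Set.range y : Set ℕ)) : ∃ s : V ⊕ Fin k,
      (∀ j, s = Sum.inr j → y j = i) ∧ ∀ j : V, s = Sum.inl j → (j : ℕ) = i ∧ ¬ ∃ l, y l = i := by
    by_cases hi : ∃ j, y j = i
    · exact ⟨Sum.inr hi.choose, by rintro _ ⟨⟩; exact hi.choose_spec, by simp⟩
    · exact ⟨Sum.inl ⟨i, i.2.resolve_right hi⟩, by simp, by rintro _ ⟨⟩; exact ⟨rfl, hi⟩⟩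
  choose g hg₁ hg₂ using hg
  have hext {D : Type w} (δ : ℕ → D) (c : Fin k → D) (i : (V ∪ Set.range y : Set ℕ)) :
      Function.extend y c δ i = Sum.elim (fun i : V => δ i) c (g i) := by
    rcases hs : g i with j | j
    · obtain ⟨h1, h2⟩ := hg₂ i j hs
      rw [Function.extend_apply' _ _ _ h2, Sum.elim_inl, h1]
    · rw [← hg₁ i j hs, y.injective.extend_apply, Sum.elim_inr]
  exact ⟨F, fun c => (hF c).reindex g (hext β c) (hext β' (F c))⟩

theorem extend_const_eq_update {D : Type w} (y : ℕ) (d : D) (δ : ℕ → D) :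
    Function.extend (fun _ : Fin 1 => y) (fun _ => d) δ = Function.update δ y d := by
  funext i
  by_cases h : i = y
  · subst h
    rw [Function.update_self]
    exact (Function.injective_of_subsingleton fun _ : Fin 1 => i).extend_apply _ _ 0
  · rw [Function.update_of_ne h, Function.extend_apply' _ _ _ (by rintro ⟨_, rfl⟩; exact h rfl)]

theorem HanfEquiv.holds_eq_iff [L.IsRelational] {r : ℕ} {V : Set ℕ} {β : ℕ → A} {β' : ℕ → B}
    (h : HanfEquiv L r (fun i : V => β i) (fun i : V => β' i)) {s t : Arg L}
    (hs : ∀ i, Var.str i ∈ Arg.vars s → i ∈ V) (ht : ∀ i, Var.str i ∈ Arg.vars t → i ∈ V) :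
    Arg.val A β s = Arg.val A β t ↔ Arg.val B β' s = Arg.val B β' t := by
  obtain ⟨e, he⟩ := h.1
  rcases s with i | c
  · rcases t with j | c
    · have hi := he.center ⟨i, hs i rfl⟩
      have hj := he.center ⟨j, ht j rfl⟩
      simp only [Arg.val, ← hi, ← hj]
      exact (he.injOn.eq_iff (self_mem_ball r (fun i : V => β i) ⟨i, hs i rfl⟩)
        (self_mem_ball r (fun i : V => β i) ⟨j, ht j rfl⟩)).symm
    · exact isEmptyElim c
  · exact isEmptyElim c

theorem HanfEquiv.relMap_iff [L.IsRelational] {r : ℕ} {V : Set ℕ} {β : ℕ → A} {β' : ℕ → B}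
    (h : HanfEquiv L r (fun i : V => β i) (fun i : V => β' i)) {n : ℕ} (R : L.Relations n)
    (ts : Fin n → Arg L) (hts : ∀ j i, Var.str i ∈ Arg.vars (ts j) → i ∈ V) :
    RelMap R (fun j => Arg.val A β (ts j)) ↔ RelMap R (fun j => Arg.val B β' (ts j)) := by
  obtain ⟨e, he⟩ := h.1
  have key (s : Arg L) (hs : ∀ i, Var.str i ∈ Arg.vars s → i ∈ V) :
      Arg.val A β s ∈ ball L r (fun i : V => β i) ∧ Arg.val B β' s = e (Arg.val A β s) := by
    rcases s with i | c
    · exact ⟨self_mem_ball r (fun i : V => β i) ⟨i, hs i rfl⟩, (he.center ⟨i, hs i rfl⟩).symm⟩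
    · exact isEmptyElim c
  simp only [fun j => (key (ts j) (hts j)).2]
  exact (he.rel R _ fun j => (key (ts j) (hts j)).1).symm

mutual

/-- Formulas of binding width at most `m` and binding rank at most `n` do not distinguish
equivalent assignments. -/
theorem Formula.holds_iff [L.IsRelational] [Finite A] [Finite B] (m : ℕ) :
    ∀ (φ : Formula L P) (n : ℕ) (V : Set ℕ) (β : ℕ → A) (β' : ℕ → B) (γ : ℕ → ℤ),
      φ.bw ≤ m → φ.br ≤ n → (∀ i, Var.str i ∈ φ.free → i ∈ V) →
      HanfEquiv L ((2 * m + 1) ^ n - 1) (fun i : V => β i) (fun i : V => β' i) →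
      (φ.Holds A β γ ↔ φ.Holds B β' γ)
  | .eq s t, _, _, _, _, _, _, _, hV, h => by
    simp only [Formula.Holds]
    simp only [Formula.free, Set.mem_union] at hV
    exact h.holds_eq_iff (fun i hi => hV i (Or.inl hi)) (fun i hi => hV i (Or.inr hi))
  | .rel R ts, _, _, _, _, _, _, _, hV, h => by
    simp only [Formula.Holds]
    simp only [Formula.free, Set.mem_iUnion] at hV
    exact h.relMap_iff R ts fun j i hi => hV i ⟨j, hi⟩
  | .not φ, n, V, β, β', γ, hm, hn, hV, h => by
    simp only [Formula.Holds]
    simp only [Formula.free, Formula.bw, Formula.br] at hV hm hn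
    exact not_congr (Formula.holds_iff m φ n V β β' γ hm hn hV h)
  | .or φ ψ, n, V, β, β', γ, hm, hn, hV, h => by
    simp only [Formula.Holds]
    simp only [Formula.free, Formula.bw, Formula.br, max_le_iff, Set.mem_union] at hV hm hn
    exact or_congr (Formula.holds_iff m φ n V β β' γ hm.1 hn.1 (fun i hi => hV i (Or.inl hi)) h)
      (Formula.holds_iff m ψ n V β β' γ hm.2 hn.2 (fun i hi => hV i (Or.inr hi)) h)
  | .exStr y φ, n, V, β, β', γ, hm, hn, hV, h => by
    simp only [Formula.Holds]
    simp only [Formula.free, Formula.bw, Formula.br, max_le_iff] at hV hm hn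
    obtain ⟨n, rfl⟩ : ∃ l, n = l + 1 := ⟨n - 1, by omega⟩
    obtain ⟨F, hF⟩ := h.exists_extend_equiv one_pos hm.2
      ⟨fun _ : Fin 1 => y, Function.injective_of_subsingleton _⟩
    have key (c : Fin 1 → A) : φ.Holds A (Function.update β y (c 0)) γ ↔
        φ.Holds B (Function.update β' y (F c 0)) γ := by
      have hc {D : Type w} (c : Fin 1 → D) : c = fun _ => c 0 :=
        funext fun i => by rw [Subsingleton.elim i 0]
      refine Formula.holds_iff m φ n _ _ _ γ hm.1 (by omega) (fun i hi => ?_)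
        (by simpa only [Function.Embedding.coeFn_mk, ← extend_const_eq_update, ← hc] using hF c)
      by_cases hiy : i = y
      · exact Or.inr ⟨0, hiy.symm⟩
      · exact Or.inl (hV i ⟨hi, by simpa using hiy⟩)
    constructor
    · rintro ⟨a, ha⟩
      exact ⟨F (fun _ => a) 0, (key fun _ => a).1 ha⟩
    · rintro ⟨b, hb⟩
      exact ⟨F.symm (fun _ => b) 0, (key _).2 (by simpa using hb)⟩
  | .pred Q ts, n, V, β, β', γ, hm, hn, hV, h => by
    simp only [Formula.Holds]
    simp only [Formula.free, Formula.bw, Formula.br, Finset.sup_le_iff, Finset.mem_univ,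
      true_implies, Set.mem_iUnion] at hV hm hn
    have (i : Fin (P.arity Q)) : (ts i).val A β γ = (ts i).val B β' γ :=
      CountingTerm.val_eq m (ts i) n V β β' γ (hm i) (hn i) (fun j hj => hV j ⟨i, hj⟩) h
    simp only [this]
  | .exNum κ φ, n, V, β, β', γ, hm, hn, hV, h => by
    simp only [Formula.Holds]
    simp only [Formula.free, Formula.bw, Formula.br] at hV hm hn
    -- The matching of the universes makes both ranges of the number quantifier equal.
    rw [Nat.card_congr h.2.choose]
    exact exists_congr fun l => and_congr_right fun _ =>
      Formula.holds_iff m φ n V β β' _ hm hn (fun i hi => hV i ⟨hi, by simp⟩) h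

/-- Counting terms of binding width at most `m` and binding rank at most `n` do not distinguish
equivalent assignments. -/
theorem CountingTerm.val_eq [L.IsRelational] [Finite A] [Finite B] (m : ℕ) :
    ∀ (t : CountingTerm L P) (n : ℕ) (V : Set ℕ) (β : ℕ → A) (β' : ℕ → B) (γ : ℕ → ℤ),
      t.bw ≤ m → t.br ≤ n → (∀ i, Var.str i ∈ t.free → i ∈ V) →
      HanfEquiv L ((2 * m + 1) ^ n - 1) (fun i : V => β i) (fun i : V => β' i) →
      t.val A β γ = t.val B β' γ
  | .count k hk y φ, n, V, β, β', γ, hm, hn, hV, h => by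
    simp only [CountingTerm.val]
    simp only [CountingTerm.free, CountingTerm.bw, CountingTerm.br, max_le_iff] at hV hm hn
    obtain ⟨n, rfl⟩ : ∃ l, n = l + 1 := ⟨n - 1, by omega⟩
    obtain ⟨F, hF⟩ := h.exists_extend_equiv hk hm.1 y
    refine congrArg Nat.cast (Nat.card_congr (F.subtypeEquiv fun c => ?_))
    refine Formula.holds_iff m φ n _ _ _ γ hm.2 (by omega) (fun i hi => ?_) (hF c)
    by_cases hiy : i ∈ Set.range y
    · exact Or.inr hiy
    · refine Or.inl (hV i ⟨hi, ?_⟩)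
      rintro ⟨j, hj⟩
      exact hiy ⟨j, Var.str.inj hj⟩
  | .int i, _, _, _, _, _, _, _, _, _ => by simp only [CountingTerm.val]
  | .add s t, n, V, β, β', γ, hm, hn, hV, h => by
    simp only [CountingTerm.val]
    simp only [CountingTerm.free, CountingTerm.bw, CountingTerm.br, max_le_iff,
      Set.mem_union] at hV hm hn
    rw [CountingTerm.val_eq m s n V β β' γ hm.1 hn.1 (fun i hi => hV i (Or.inl hi)) h,
      CountingTerm.val_eq m t n V β β' γ hm.2 hn.2 (fun i hi => hV i (Or.inr hi)) h]
  | .mul s t, n, V, β, β', γ, hm, hn, hV, h => by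
    simp only [CountingTerm.val]
    simp only [CountingTerm.free, CountingTerm.bw, CountingTerm.br, max_le_iff,
      Set.mem_union] at hV hm hn
    rw [CountingTerm.val_eq m s n V β β' γ hm.1 hn.1 (fun i hi => hV i (Or.inl hi)) h,
      CountingTerm.val_eq m t n V β β' γ hm.2 hn.2 (fun i hi => hV i (Or.inr hi)) h]
  | .numVar κ, _, _, _, _, _, _, _, _, _ => by simp only [CountingTerm.val]

end

end Invariance

-- From `r`-equivalence to the invariant

section HanfLocality

variable {L : FirstOrder.Language.{u, v}} [L.IsRelational] {P : NumPredCollection.{p}}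
  {A B : Type w} [L.Structure A] [L.Structure B]

/-- A `PartialEquiv` has total underlying maps, so the isomorphism is extended by arbitrary values
outside the spheres. -/
theorem SphereIso.ballIso [Nonempty A] [Nonempty B] {r n : ℕ} {a : Fin n → A} {b : Fin n → B}
    (h : SphereIso L r a b) : BallIso L r a b := by
  classical
  obtain ⟨e, he⟩ := h
  have h1 (x : A) (hx : x ∈ ball L r a) :
      (if h : x ∈ ball L r a then (e ⟨x, h⟩ : B) else Classical.arbitrary B) = e ⟨x, hx⟩ :=
    dif_pos hx
  have h2 (x : B) (hx : x ∈ ball L r b) :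
      (if h : x ∈ ball L r b then (e.symm ⟨x, h⟩ : A) else Classical.arbitrary A) =
        e.symm ⟨x, hx⟩ := dif_pos hx
  refine ⟨{ toFun := fun x => if h : x ∈ ball L r a then (e ⟨x, h⟩ : B) else Classical.arbitrary B
            invFun := fun x =>
              if h : x ∈ ball L r b then (e.symm ⟨x, h⟩ : A) else Classical.arbitrary A
            source := ball L r a
            target := ball L r b
            map_source' := fun x hx => ?_
            map_target' := fun x hx => ?_
            left_inv' := fun x hx => ?_
            right_inv' := fun x hx => ?_ }, ⟨rfl, rfl, fun i => ?_, fun {n} R t ht => ?_⟩⟩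
  · rw [h1 x hx]; exact (e ⟨x, hx⟩).2
  · rw [h2 x hx]; exact (e.symm ⟨x, hx⟩).2
  · rw [h1 x hx, h2 _ (e ⟨x, hx⟩).2]
    exact congrArg Subtype.val (e.symm_apply_apply ⟨x, hx⟩)
  · rw [h2 x hx, h1 _ (e.symm ⟨x, hx⟩).2]
    exact congrArg Subtype.val (e.apply_symm_apply ⟨x, hx⟩)
  · exact (h1 (a i) (self_mem_ball r a i)).trans (congrArg Subtype.val (he i))
  · have hR := e.map_rel R fun j => ⟨t j, ht j⟩
    have ht' : (fun j => if h : t j ∈ ball L r a then (e ⟨t j, h⟩ : B) else Classical.arbitrary B) =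
        fun j => (e ⟨t j, ht j⟩ : B) := funext fun j => h1 (t j) (ht j)
    change RelMap R (fun j => if h : t j ∈ ball L r a then (e ⟨t j, h⟩ : B) else
      Classical.arbitrary B) ↔ _
    rw [ht']
    exact hR

/-- Restrict the isomorphisms for `(a, c)` to `a` or to `c`. For `a`, any one `c` suffices, which
uses that `A` is non-empty. -/
theorem REquiv.hanfEquiv [Nonempty A] [Nonempty B] {r k : ℕ} {a : Fin k → A} {b : Fin k → B}
    (h : REquiv L r a b) : HanfEquiv L r a b := by
  obtain ⟨f, hf⟩ := h
  refine ⟨(hf (Classical.arbitrary A)).ballIso.reindex le_rfl Fin.castSucc (by simp) (by simp),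
    f, fun c => (hf c).ballIso.reindex le_rfl (fun _ => Fin.last k) (by simp) (by simp)⟩

theorem Formula.sat_iff [Finite A] [Finite B] [Nonempty A] [Nonempty B] (φ : Formula L P) {k : ℕ}
    (x : Fin k ↪ ℕ) (hfree : φ.free ⊆ Set.range (fun j => Var.str (x j))) {a : Fin k → A}
    {b : Fin k → B} (h : REquiv L ((2 * φ.bw + 1) ^ φ.br - 1) a b) :
    φ.Sat A x a ↔ φ.Sat B x b := by
  have hV : ∀ i, Var.str i ∈ φ.free → i ∈ Set.range x := fun i hi => by
    obtain ⟨j, hj⟩ := hfree hi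
    exact ⟨j, Var.str.inj hj⟩
  have key (β : ℕ → A) (β' : ℕ → B) (γ : ℕ → ℤ) (hβ : ∀ j, β (x j) = a j)
      (hβ' : ∀ j, β' (x j) = b j) : φ.Holds A β γ ↔ φ.Holds B β' γ := by
    refine Formula.holds_iff φ.bw φ φ.br (Set.range x) β β' γ le_rfl le_rfl hV
      (h.hanfEquiv.reindex (fun i => i.2.choose) (fun i => ?_) (fun i => ?_))
    · rw [← hβ, i.2.choose_spec]
    · rw [← hβ', i.2.choose_spec]
  constructor
  · intro hA β' γ hβ'
    -- `Sat` quantifies over assignments, so using it requires one that extends `a`; its other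
    -- values are immaterial.
    have hβ : ∀ j, Function.extend x a (fun _ => Classical.arbitrary A) (x j) = a j :=
      x.injective.extend_apply _ _
    exact (key _ β' γ hβ hβ').1 (hA _ γ hβ)
  · intro hB β γ hβ
    have hβ' : ∀ j, Function.extend x b (fun _ => Classical.arbitrary B) (x j) = b j :=
      x.injective.extend_apply _ _
    exact (key β _ γ hβ hβ').2 (hB _ γ hβ')

end HanfLocality

end FOCN

theorem mainTheorem4 (P : FOCN.NumPredCollection.{p}) (L : FirstOrder.Language.{u, v}) [L.IsRelational]
    [Finite L.Symbols] [IsEmpty (L.Relations 0)] (φ : FOCN.Formula L P)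
    (k : ℕ) (x : Fin k ↪ ℕ) (hfree : φ.free ⊆ Set.range (fun j => FOCN.Var.str (x j))) :
    FOCN.Formula.IsHanfLocal.{u, v, w, p} φ x ∧
      FOCN.Formula.hanfRank.{u, v, w, p} φ x < (2 * φ.bw + 1) ^ φ.br := by
  have h : FOCN.Formula.IsHanfLocalWith.{u, v, w, p} φ x ((2 * φ.bw + 1) ^ φ.br - 1) :=
    fun A B _ _ _ _ _ _ a b hab => φ.sat_iff x hfree hab
  exact ⟨⟨_, h⟩, (Nat.sInf_le h).trans_lt (Nat.sub_lt (by positivity) one_pos)⟩
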